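/- Let $\mathbb{U}X$ be the set of ultrafilters on a set $X$, with the Stone topology $\beta$, whose base consists of the sets $\{\mathcal{U}\in\mathbb{U}X : A\in\mathcal{U}\}$ for $A\subseteq X$. Let $\mathbb{U}^{\circ}X\subseteq\mathbb{U}X$ be the set of free ultrafilters, i.e. those with $\bigcap_{U\in\mathcal{U}}U=\emptyset$. All filters are proper. For a filter $\mathcal{F}$ on a topological space $X$, write $\operatorname{adh}\mathcal{F}$ for its set of cluster points. A set $K\subseteq X$ is compactoid if $\operatorname{adh}\mathcal{F}\neq\emptyset$ for every filter $\mathcal{F}$ on $X$ all of whose elements meet $K$. The space $X$ is locally compactoid if every convergent filter on $X$ has a compactoid element. It is countably ultracomplete if there is a countable family $\mathbb{D}$ of filters on $X$ with empty adherence such that every filter $\mathcal{G}$ on $X$ with $\operatorname{adh}\mathcal{G}=\emptyset$ contains some $\mathcal{D}\in\mathbb{D}$. A topological space $Y$ is hemicompact if there is a sequence $(K_n)_{n\in\omega}$ of compact subsets of $Y$ such that every compact subset of $Y$ is contained in some $K_n$. There are a set $X$ and a subset $S$ of $\mathbb{U}^{\circ}X$ such that $S$, as a subspace of $(\mathbb{U}X,\beta)$,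 is hemicompact, but $S$ is not closed in $(\mathbb{U}X,\beta)$. More precisely, there is a topology on $X$ that is countably ultracomplete but not locally compactoid, such that the set $S$ of all ultrafilters on $X$ that converge to no point of $X$ is contained in $\mathbb{U}^{\circ}X$, hemicompact, and not closed in $(\mathbb{U}X,\beta)$. -/

import Mathlib

open Set Filter Topology

namespace ConvUltra

/-- `U°X`: the ultrafilters on `X` with empty kernel. -/
def freeUltrafilters (X : Type*) : Set (Ultrafilter X) :=
  {U | (⋂₀ {A : Set X | A ∈ U}) = ∅}

/-- The set of ultrafilters on `X` that converge to no point. -/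
def nonconvergentUltrafilters (X : Type*) [TopologicalSpace X] : Set (Ultrafilter X) :=
  {U | ∀ x : X, ¬ (U : Filter X) ≤ 𝓝 x}

/-- The adherence of a filter: the set of its cluster points. -/
def adh {X : Type*} [TopologicalSpace X] (F : Filter X) : Set X :=
  {x | ClusterPt x F}

/-- `K` is compactoid if every proper filter meshing with `K` has a cluster point in the whole
space (which need not belong to `K`). -/
def IsCompactoid {X : Type*} [TopologicalSpace X] (K : Set X) : Prop :=
  ∀ F : Filter X, F.NeBot → (∀ A ∈ F, (A ∩ K).Nonempty) → (adh F).Nonempty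

/-- Every convergent (proper) filter has a compactoid element. -/
def IsLocallyCompactoid (X : Type*) [TopologicalSpace X] : Prop :=
  ∀ F : Filter X, F.NeBot → (∃ x : X, F ≤ 𝓝 x) → ∃ K ∈ F, IsCompactoid K

/-- A family of proper filters without adherence is ultracocomplete if every proper filter
without adherence is finer than some member of the family.  In Mathlib's order on filters
`G ≤ D` means that `G` is finer than `D`. -/
def IsUltracocomplete {X : Type*} [TopologicalSpace X] (𝔻 : Set (Filter X)) : Prop :=
  (∀ D ∈ 𝔻, D.NeBot ∧ adh D = ∅) ∧
    ∀ G : Filter X, G.NeBot → adh G = ∅ → ∃ D ∈ 𝔻, G ≤ D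

/-- Existence of a countable ultracocomplete family of filters. -/
def IsCountablyUltracomplete (X : Type*) [TopologicalSpace X] : Prop :=
  ∃ 𝔻 : Set (Filter X), 𝔻.Countable ∧ IsUltracocomplete 𝔻

/-- The subset `S` of a topological space is hemicompact (in its subspace topology): there is a
sequence of compact subsets of `S` such that every compact subset of `S` is contained in a term
of the sequence. -/
def IsHemicompact {Y : Type*} [TopologicalSpace Y] (S : Set Y) : Prop :=
  ∃ K : ℕ → Set Y, (∀ n, K n ⊆ S ∧ IsCompact (K n)) ∧
    ∀ C : Set Y, C ⊆ S → IsCompact C → ∃ n, C ⊆ K n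

end ConvUltra

namespace ConvUltra

/-! The only nonisolated point is approached by going to ever higher columns, so an ultrafilter
fails to converge exactly when it is free and contains a finite union of columns. Thus `S` is the
increasing union of the compact sets `{U | U ≤ columnFilter n}`, each cut out of `S` by a basic open
set; any compact part of `S` therefore lies in one of them (`exists_subset_of_isCompact`). Every
further column carries a free ultrafilter, so `S` is not compact, hence not closed in the compact
space of ultrafilters. The filters `columnFilter n` witness countable ultracompleteness
(`exists_le_columnFilter`). -/

/-- The topology on `ℕ × ℕ` in which every point other than `(0, 0)` is isolated and the sets
`{p | n ≤ p.1} ∪ {(0, 0)}` form a neighbourhood base at `(0, 0)`. -/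
abbrev columnTopology : TopologicalSpace (ℕ × ℕ) :=
  nhdsAdjoint (0, 0) (comap Prod.fst atTop)

/-- The filter of cofinite subsets of the first `n + 1` columns. -/
def columnFilter (n : ℕ) : Filter (ℕ × ℕ) :=
  cofinite ⊓ 𝓟 {p | p.1 ≤ n}

theorem columnFilter_mono {m n : ℕ} (h : m ≤ n) : columnFilter m ≤ columnFilter n :=
  inf_le_inf_left _ (principal_mono.2 fun _ hp => le_trans hp h)

theorem disjoint_columnFilter_comap_fst (n : ℕ) :
    Disjoint (columnFilter n) (comap Prod.fst atTop) := by
  have h : {p : ℕ × ℕ | n < p.1} ∈ comap (Prod.fst : ℕ × ℕ → ℕ) atTop :=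
    preimage_mem_comap (Ioi_mem_atTop n)
  refine Filter.disjoint_iff.2
    ⟨{p | p.1 ≤ n}, mem_inf_of_right (mem_principal_self _), _, h, ?_⟩
  exact Set.disjoint_left.2 fun p hp hq => Nat.not_lt.2 hp hq

theorem disjoint_columnFilter_pure (n : ℕ) (x : ℕ × ℕ) :
    Disjoint (columnFilter n) (pure x) := by
  rw [← principal_singleton, disjoint_principal_right]
  exact mem_inf_of_left (Set.finite_singleton x).compl_mem_cofinite

theorem disjoint_columnFilter_nhds (n : ℕ) (x : ℕ × ℕ) :
    Disjoint (columnFilter n) (@nhds _ columnTopology x) := by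
  by_cases hx : x = (0, 0)
  · subst hx
    rw [nhds_nhdsAdjoint_same, disjoint_sup_right]
    exact ⟨disjoint_columnFilter_pure n _, disjoint_columnFilter_comap_fst n⟩
  · rw [nhds_nhdsAdjoint_of_ne _ hx]
    exact disjoint_columnFilter_pure n x

/-- A filter disjoint from all neighbourhood filters is finer than some `columnFilter n`. -/
theorem exists_le_columnFilter {G : Filter (ℕ × ℕ)}
    (hG : ∀ x, Disjoint G (@nhds _ columnTopology x)) : ∃ n, G ≤ columnFilter n := by
  have hcof : G ≤ cofinite := le_cofinite_iff_compl_singleton_mem.2 fun x => by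
    rw [← disjoint_principal_right, principal_singleton]
    exact (hG x).mono_right (@pure_le_nhds _ columnTopology x)
  have h0 := hG (0, 0)
  rw [nhds_nhdsAdjoint_same, disjoint_sup_right] at h0
  -- Since `t` contains all columns from some index on, `s` is confined to finitely many columns.
  obtain ⟨s, hs, t, ht, hst⟩ := Filter.disjoint_iff.1 h0.2
  obtain ⟨u, hu, hut⟩ := mem_comap.1 ht
  obtain ⟨n, hn⟩ := mem_atTop_sets.1 hu
  refine ⟨n, le_inf hcof (le_principal_iff.2 (mem_of_superset hs fun p hp => ?_))⟩
  by_contra hpn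
  exact Set.disjoint_left.1 hst hp (hut (hn _ (not_le.1 hpn).le))

/-- The filter of cofinite subsets of a single column is proper. -/
theorem neBot_cofinite_inf_column (n : ℕ) :
    (cofinite ⊓ 𝓟 {p : ℕ × ℕ | p.1 = n}).NeBot := by
  rw [cofinite_inf_principal_neBot_iff]
  refine Set.infinite_of_injective_forall_mem (f := fun m : ℕ => (n, m)) ?_ fun _ => rfl
  exact fun a b h => congrArg Prod.snd h

theorem cofinite_inf_column_le (n : ℕ) :
    cofinite ⊓ 𝓟 {p : ℕ × ℕ | p.1 = n} ≤ columnFilter n :=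
  inf_le_inf_left _ (principal_mono.2 fun _ hp => le_of_eq hp)

instance columnFilter_neBot (n : ℕ) : (columnFilter n).NeBot :=
  (neBot_cofinite_inf_column n).mono (cofinite_inf_column_le n)

theorem adh_eq_empty_iff {X : Type*} [TopologicalSpace X] {F : Filter X} :
    adh F = ∅ ↔ ∀ x, Disjoint F (𝓝 x) := by
  simp only [Set.eq_empty_iff_forall_notMem, adh, Set.mem_ofPred_eq, ClusterPt, neBot_iff, not_not,
    disjoint_iff, inf_comm]

theorem mem_nonconvergentUltrafilters_iff_disjoint {X : Type*} [TopologicalSpace X]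
    {U : Ultrafilter X} :
    U ∈ nonconvergentUltrafilters X ↔ ∀ x, Disjoint (U : Filter X) (𝓝 x) :=
  forall_congr' fun _ => Ultrafilter.disjoint_iff_not_le.symm

theorem nonconvergentUltrafilters_subset_free (X : Type*) [TopologicalSpace X] :
    nonconvergentUltrafilters X ⊆ freeUltrafilters X := by
  refine fun U hU => Set.eq_empty_iff_forall_notMem.2 fun x hx => hU x fun A hA => ?_
  by_contra hAU
  exact hx Aᶜ (Ultrafilter.compl_mem_iff_notMem.2 hAU) (mem_of_mem_nhds hA)

theorem isClosed_setOf_ultrafilter_le {X : Type*} (F : Filter X) :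
    IsClosed {U : Ultrafilter X | (U : Filter X) ≤ F} := by
  have h : {U : Ultrafilter X | (U : Filter X) ≤ F} = ⋂ A ∈ F, {U : Ultrafilter X | A ∈ U} := by
    ext U
    simp [Filter.le_def]
  rw [h]
  exact isClosed_biInter fun A _ => ultrafilter_isClosed_basic A

theorem mem_nonconvergent_column_iff {U : Ultrafilter (ℕ × ℕ)} :
    U ∈ @nonconvergentUltrafilters _ columnTopology ↔
      ∃ n, (U : Filter (ℕ × ℕ)) ≤ columnFilter n := by
  rw [@mem_nonconvergentUltrafilters_iff_disjoint _ columnTopology]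
  exact ⟨exists_le_columnFilter, fun ⟨n, hn⟩ x => (disjoint_columnFilter_nhds n x).mono_left hn⟩

/-- A compact set of nonconvergent ultrafilters lives on finitely many columns. -/
theorem exists_subset_of_isCompact {C : Set (Ultrafilter (ℕ × ℕ))}
    (hC : C ⊆ @nonconvergentUltrafilters _ columnTopology) (hc : IsCompact C) :
    ∃ n, C ⊆ {U | (U : Filter (ℕ × ℕ)) ≤ columnFilter n} := by
  obtain ⟨n, hn⟩ := hc.elim_directed_cover
    (fun n => {U : Ultrafilter (ℕ × ℕ) | {p : ℕ × ℕ | p.1 ≤ n} ∈ U})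
    (fun n => ultrafilter_isOpen_basic _)
    (fun U hU => by
      obtain ⟨n, hn⟩ := mem_nonconvergent_column_iff.1 (hC hU)
      exact Set.mem_iUnion.2 ⟨n, hn (mem_inf_of_right (mem_principal_self _))⟩)
    (directed_of_isDirected_le fun m n hmn U hU =>
      mem_of_superset hU fun p hp => le_trans hp hmn)
  refine ⟨n, fun U hU => ?_⟩
  obtain ⟨m, hm⟩ := mem_nonconvergent_column_iff.1 (hC hU)
  -- The index `m` depends on `U`, but only freeness is taken from it; the column bound is the
  -- uniform `n`.
  exact le_inf (hm.trans inf_le_left) (le_principal_iff.2 (hn hU))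

theorem isHemicompact_nonconvergent_column :
    IsHemicompact (@nonconvergentUltrafilters _ columnTopology) :=
  ⟨fun n => {U | (U : Filter (ℕ × ℕ)) ≤ columnFilter n},
    fun n => ⟨fun _ hU => mem_nonconvergent_column_iff.2 ⟨n, hU⟩,
      (isClosed_setOf_ultrafilter_le _).isCompact⟩,
    fun _ => exists_subset_of_isCompact⟩

theorem not_isClosed_nonconvergent_column :
    ¬ IsClosed (@nonconvergentUltrafilters _ columnTopology) := by
  intro h
  -- A closed `S` would be compact, hence confined to columns up to `n`; a free ultrafilter on
  -- column `n + 1` contradicts this.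
  obtain ⟨n, hn⟩ := exists_subset_of_isCompact subset_rfl h.isCompact
  have := neBot_cofinite_inf_column (n + 1)
  let U := Ultrafilter.of (cofinite ⊓ 𝓟 {p : ℕ × ℕ | p.1 = n + 1})
  have hU : (U : Filter (ℕ × ℕ)) ≤ cofinite ⊓ 𝓟 {p : ℕ × ℕ | p.1 = n + 1} := Ultrafilter.of_le _
  have hUn : {p : ℕ × ℕ | p.1 ≤ n} ∈ (U : Filter (ℕ × ℕ)) :=
    hn (mem_nonconvergent_column_iff.2 ⟨n + 1, hU.trans (cofinite_inf_column_le _)⟩)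
      (mem_inf_of_right (mem_principal_self _))
  have hU' : {p : ℕ × ℕ | p.1 = n + 1} ∈ (U : Filter (ℕ × ℕ)) :=
    hU (mem_inf_of_right (mem_principal_self _))
  obtain ⟨p, hp, hp'⟩ := U.nonempty_of_mem (inter_mem hUn hU')
  simp only [Set.mem_ofPred_eq] at hp hp'
  omega

theorem isCountablyUltracomplete_column :
    @IsCountablyUltracomplete (ℕ × ℕ) columnTopology := by
  refine ⟨Set.range columnFilter, Set.countable_range _, ?_, fun G _ hG => ?_⟩
  · rintro _ ⟨n, rfl⟩
    exact ⟨columnFilter_neBot n,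
      (@adh_eq_empty_iff _ columnTopology _).2 (disjoint_columnFilter_nhds n)⟩
  · obtain ⟨n, hn⟩ := exists_le_columnFilter ((@adh_eq_empty_iff _ columnTopology _).1 hG)
    exact ⟨_, ⟨n, rfl⟩, hn⟩

theorem not_isLocallyCompactoid_column :
    ¬ @IsLocallyCompactoid (ℕ × ℕ) columnTopology := by
  intro h
  obtain ⟨K, hK, hKc⟩ := h (@nhds _ columnTopology (0, 0))
    (@nhds_neBot _ columnTopology _) ⟨(0, 0), le_rfl⟩
  rw [nhds_nhdsAdjoint_same] at hK
  obtain ⟨u, hu, huK⟩ := mem_comap.1 (mem_sup.1 hK).2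
  obtain ⟨n, hn⟩ := mem_atTop_sets.1 hu
  have hne := neBot_cofinite_inf_column n
  -- A neighbourhood of `(0, 0)` contains a whole column, whose cofinite filter has no cluster point
  -- anywhere.
  have hcol : {p : ℕ × ℕ | p.1 = n} ⊆ K := fun p hp => huK (hn _ (ge_of_eq hp))
  refine (hKc _ hne fun A hA => hne.nonempty_of_mem (inter_mem hA
    (mem_inf_of_right (mem_principal.2 hcol)))).ne_empty ?_
  exact (@adh_eq_empty_iff _ columnTopology _).2 fun x =>
    (disjoint_columnFilter_nhds n x).mono_left (cofinite_inf_column_le n)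

end ConvUltra

/-- The type `Ultrafilter X` carries Mathlib's topology with base the sets `{U | A ∈ U}`, that is,
the Stone topology `β`. -/
theorem mainTheorem12 :
    ∃ (X : Type) (_ : TopologicalSpace X) (S : Set (Ultrafilter X)),
      ConvUltra.IsCountablyUltracomplete X ∧
      ¬ ConvUltra.IsLocallyCompactoid X ∧
      S = ConvUltra.nonconvergentUltrafilters X ∧
      S ⊆ ConvUltra.freeUltrafilters X ∧
      ConvUltra.IsHemicompact S ∧
      ¬ IsClosed S :=
  ⟨ℕ × ℕ, ConvUltra.columnTopology, _, ConvUltra.isCountablyUltracomplete_column,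
    ConvUltra.not_isLocallyCompactoid_column, rfl,
    @ConvUltra.nonconvergentUltrafilters_subset_free _ ConvUltra.columnTopology,
    ConvUltra.isHemicompact_nonconvergent_column, ConvUltra.not_isClosed_nonconvergent_column⟩
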